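/- \textbf{Theorem.} Let $\varepsilon>0$ be a real number and let $n\ge 1$. Then the $\varepsilon$-approximate total closed projection operator on $\mathbb{R}^n$ (with the Euclidean metric $d$), $$\varepsilon\text{-}\mathrm{Proj}_{\mathbb{R}^n}:\subseteq \mathbb{R}^n\times\mathcal{A}(\mathbb{R}^n)\rightrightarrows\mathbb{R}^n,\qquad (x,A)\mapsto\{y\in A : d(x,y)\le(1+\varepsilon)\,d(x,A)\},$$ whose domain consists of all pairs $(x,A)$ with $x\in\mathbb{R}^n$ and $A\subseteq\mathbb{R}^n$ closed and nonempty, is computable. That is, there is a computable partial function $F:\subseteq\mathbb{N}^{\mathbb{N}}\to\mathbb{N}^{\mathbb{N}}$ (a single algorithm which reads an infinite input sequence and produces, one after the other, the entries of an infinite output sequence) such that, for every such pair $(x,A)$, every Cauchy name $p$ of $x$ and every total-information name $p'$ of $A$, $F(\langle p,p'\rangle)$ is defined and is a Cauchy name of some $y\in A$ with $d(x,y)\le(1+\varepsilon)\,d(x,A)$. Here $\alpha:\mathbb{N}\to\mathbb{Q}^n$ is any effective enumeration of $\mathbb{Q}^n$, $(r_m)_m$ is any effective enumeration of the nonnegative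 rationals, and $B_{\langle k,m\rangle}$ is the open ball with centre $\alpha(k)$ and radius $r_m$, with $\langle\cdot,\cdot\rangle$ a standard computable pairing on $\mathbb{N}$; for sequences, $\langle p,p'\rangle=(p(0),p'(0),p(1),p'(1),\dots)$. A \emph{Cauchy name} of $x\in\mathbb{R}^n$ is a sequence $p\in\mathbb{N}^{\mathbb{N}}$ with $d(\alpha(p(i)),\alpha(p(j)))\le 2^{-i}$ for all $i\le j$ and $\lim_i\alpha(p(i))=x$. A \emph{total-information name} of a closed set $A$ is a sequence $\langle p_0,p_1\rangle$ such that $A=\mathbb{R}^n\setminus\bigcup_{k\in\mathrm{range}(p_0)}B_k$ and, for all $k\in\mathbb{N}$, $k\in\mathrm{range}(p_1)$ if and only if $B_k\cap A\neq\emptyset$. -/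

import Mathlib

open Filter Topology TopologicalSpace

noncomputable section

/-! ### Type-2 computability: programs reading an infinite input sequence -/

/-- Programs that compute with natural numbers and may at any time read a digit of an infinite
input sequence `p : ℕ → ℕ`. This is the syntax of the partial recursive functions with one more
basic instruction, `oracle`. -/
inductive OracleCode : Type
  | zero : OracleCode
  | succ : OracleCode
  | left : OracleCode
  | right : OracleCode
  | oracle : OracleCode
  | pair : OracleCode → OracleCode → OracleCode
  | comp : OracleCode → OracleCode → OracleCode
  | prec : OracleCode → OracleCode → OracleCode
  | rfind : OracleCode → OracleCode

/-- The partial function computed by a program on the input sequence `p`. The clauses are those of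
`Nat.RecursiveIn {p}`; here the program is independent of `p`. -/
def OracleCode.eval (p : ℕ → ℕ) : OracleCode → ℕ →. ℕ
  | .zero => fun _ => Part.some 0
  | .succ => fun n => Part.some (n + 1)
  | .left => fun n => Part.some n.unpair.1
  | .right => fun n => Part.some n.unpair.2
  | .oracle => fun n => Part.some (p n)
  | .pair f g => fun n => (f.eval p n).bind fun a => (g.eval p n).map fun b => Nat.pair a b
  | .comp f g => fun n => (g.eval p n).bind fun a => f.eval p a
  | .prec f g => fun n =>
      n.unpair.2.rec (f.eval p n.unpair.1) fun y ih =>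
        ih.bind fun i => g.eval p (Nat.pair n.unpair.1 (Nat.pair y i))
  | .rfind f => fun a =>
      Nat.rfind fun n => (f.eval p (Nat.pair a n)).map fun m => decide (m = 0)

/-- A partial function on Baire space is computable if a single program, given read access to the
input `p`, produces the successive entries of the output: `F p = q` iff the program yields `q k`
for every `k` (and `F p` is undefined iff the program fails to yield some entry). -/
def BaireComputable (F : (ℕ → ℕ) →. (ℕ → ℕ)) : Prop :=
  ∃ c : OracleCode, ∀ p q : ℕ → ℕ, q ∈ F p ↔ ∀ k, q k ∈ c.eval p k

/-! ### Represented spaces and computable multi-valued functions -/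

/-- A naming system for `X`: a partial function from Baire space to `X`, given by its graph
(`IsName p x` says that `p` is a name of `x`). -/
structure BaireRepresentation (X : Type*) where
  IsName : (ℕ → ℕ) → X → Prop
  unique : ∀ p x y, IsName p x → IsName p y → x = y

/-- The even-indexed half `p₀` of `p = ⟨p₀, p₁⟩`. -/
def evenPart (p : ℕ → ℕ) : ℕ → ℕ := fun i => p (2 * i)

/-- The odd-indexed half `p₁` of `p = ⟨p₀, p₁⟩`. -/
def oddPart (p : ℕ → ℕ) : ℕ → ℕ := fun i => p (2 * i + 1)

/-- The product representation: `⟨p₀, p₁⟩` names `(x, y)` iff `p₀` names `x` and `p₁` names `y`. -/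
def BaireRepresentation.prod {X Y : Type*} (δ : BaireRepresentation X) (δ' : BaireRepresentation Y) :
    BaireRepresentation (X × Y) where
  IsName p z := δ.IsName (evenPart p) z.1 ∧ δ'.IsName (oddPart p) z.2
  unique _ _ _ hx hy := Prod.ext (δ.unique _ _ _ hx.1 hy.1) (δ'.unique _ _ _ hx.2 hy.2)

/-- A partial multi-valued function from `X` to `Y`: its domain and its sets of admissible values. -/
structure PartialMultimap (X Y : Type*) where
  dom : Set X
  val : X → Set Y

/-- `F` realizes `f`: it sends every name of every point `x` of the domain of `f` to a name of some
element of `f x`. -/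
def Realizes {X Y : Type*} (δ : BaireRepresentation X) (δ' : BaireRepresentation Y)
    (F : (ℕ → ℕ) →. (ℕ → ℕ)) (f : PartialMultimap X Y) : Prop :=
  ∀ (p : ℕ → ℕ) (x : X), δ.IsName p x → x ∈ f.dom →
    ∃ q ∈ F p, ∃ y ∈ f.val x, δ'.IsName q y

/-- A partial multi-valued function between represented spaces is computable if it has a
computable realizer. -/
def ComputableMultimap {X Y : Type*} (δ : BaireRepresentation X) (δ' : BaireRepresentation Y)
    (f : PartialMultimap X Y) : Prop :=
  ∃ F : (ℕ → ℕ) →. (ℕ → ℕ), BaireComputable F ∧ Realizes δ δ' F f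

/-! ### The representations of points and of closed sets in a metric space -/

section MetricRepresentations

variable {X : Type*} [MetricSpace X]

/-- The Cauchy representation with respect to a sequence `α` in `X`: `p` names `x` iff
`α (p 0), α (p 1), …` is an effective Cauchy sequence with limit `x`. -/
def cauchyRep (α : ℕ → X) : BaireRepresentation X where
  IsName p x := (∀ i j, i ≤ j → dist (α (p i)) (α (p j)) ≤ (2 : ℝ)⁻¹ ^ i) ∧
    Tendsto (fun i => α (p i)) atTop (𝓝 x)
  unique _ _ _ hx hy := tendsto_nhds_unique hx.2 hy.2

/-- The open basic ball with index `k = ⟨n, m⟩`: its centre is `α n` and its radius is `r m`. -/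
def basicBall (α : ℕ → X) (r : ℕ → ℚ) (k : ℕ) : Set X :=
  Metric.ball (α k.unpair.1) (r k.unpair.2 : ℝ)

/-- Negative information: `p` lists basic balls whose union is the complement of `A`. -/
def IsNegativeName (α : ℕ → X) (r : ℕ → ℚ) (p : ℕ → ℕ) (A : Closeds X) : Prop :=
  (A : Set X) = (⋃ k ∈ Set.range p, basicBall α r k)ᶜ

/-- Positive information: `p` lists exactly the basic balls that meet `A`. -/
def IsPositiveName (α : ℕ → X) (r : ℕ → ℚ) (p : ℕ → ℕ) (A : Closeds X) : Prop :=
  ∀ k, k ∈ Set.range p ↔ (basicBall α r k ∩ (A : Set X)).Nonempty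

/-- Total information: `⟨p₀, p₁⟩` names `A` iff `p₀` is a negative name of `A` and `p₁` is a
positive name of `A`. -/
def totalRep (α : ℕ → X) (r : ℕ → ℚ) : BaireRepresentation (Closeds X) where
  IsName p A := IsNegativeName α r (evenPart p) A ∧ IsPositiveName α r (oddPart p) A
  unique _ _ _ hA hB := SetLike.coe_injective (hA.1.trans hB.1.symm)

end MetricRepresentations

/-- The `ε`-approximate closed projection operator on `X`. Its domain consists of the pairs `(x, A)`
with `A` closed and nonempty, and its values are the `ε`-projection points of `x` onto `A`. -/
def approxProjection (X : Type*) [MetricSpace X] (ε : ℝ) :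
    PartialMultimap (X × Closeds X) X where
  dom := {z | (z.2 : Set X).Nonempty}
  val z := {y | y ∈ (z.2 : Set X) ∧ dist z.1 y ≤ (1 + ε) * Metric.infDist z.1 (z.2 : Set X)}

/-! ### Effective numberings of rational data -/

/-- A computable sequence of rational numbers. -/
def IsComputableRatSeq (u : ℕ → ℚ) : Prop :=
  ∃ a b c : ℕ → ℕ, Computable a ∧ Computable b ∧ Computable c ∧
    ∀ k, u k = ((a k : ℚ) - (b k : ℚ)) / ((c k : ℚ) + 1)

/-- An effective enumeration of `ℚⁿ`. -/
def IsEffectiveEnumeration {n : ℕ} (α : ℕ → Fin n → ℚ) : Prop :=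
  (∀ i, IsComputableRatSeq fun k => α k i) ∧ Function.Surjective α

/-- An effective enumeration of the nonnegative rational numbers. -/
def IsEffectiveRadiusEnumeration (r : ℕ → ℚ) : Prop :=
  IsComputableRatSeq r ∧ Set.range r = {s : ℚ | 0 ≤ s}

/-- A sequence in `ℚⁿ`, viewed as a sequence of points of Euclidean space. -/
def rationalPoint {n : ℕ} (α : ℕ → Fin n → ℚ) (k : ℕ) : EuclideanSpace ℝ (Fin n) :=
  WithLp.toLp 2 fun i => (α k i : ℝ)

end

/-!
A total-information name of `A` makes `infDist x A` computable: the listed balls meeting `A` give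
upper bounds, while a lower bound is a closed ball that misses `A`, and by compactness finitely many
of the listed balls outside `A` suffice to verify this. An exact projection cannot be computed, but
with a slack `c > 1` it suffices to build a nested sequence of basic balls meeting `A`, each of
which either contains all exact projections of `x` or consists of points closer to `x` than
`c * infDist x A`. Each alternative is a strict inequality, hence is eventually confirmed whenever
it holds; and every such ball contains arbitrarily small further ones. So searching always succeeds,
and the centres found form a Cauchy name of a `c`-approximate projection.
-/

theorem OracleCode.exists_eval_eq_of_partrec {f : ℕ →. ℕ} (hf : Nat.Partrec f) :
    ∃ c : OracleCode, ∀ p, c.eval p = f := by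
  induction hf with
  | zero => exact ⟨.zero, fun p => rfl⟩
  | succ => exact ⟨.succ, fun p => rfl⟩
  | left => exact ⟨.left, fun p => rfl⟩
  | right => exact ⟨.right, fun p => rfl⟩
  | pair _ _ ihf ihg =>
    obtain ⟨cf, hcf⟩ := ihf
    obtain ⟨cg, hcg⟩ := ihg
    refine ⟨.pair cf cg, fun p => funext fun n => ?_⟩
    simp only [OracleCode.eval, hcf, hcg]
    simp [Seq.seq, Part.bind_map]
  | comp _ _ ihf ihg =>
    obtain ⟨cf, hcf⟩ := ihf
    obtain ⟨cg, hcg⟩ := ihg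
    exact ⟨.comp cf cg, fun p => funext fun n => by simp only [OracleCode.eval, hcf, hcg]; rfl⟩
  | prec _ _ ihf ihg =>
    obtain ⟨cf, hcf⟩ := ihf
    obtain ⟨cg, hcg⟩ := ihg
    exact ⟨.prec cf cg, fun p => funext fun n => by simp only [OracleCode.eval, hcf, hcg]; rfl⟩
  | rfind _ ihf =>
    obtain ⟨cf, hcf⟩ := ihf
    exact ⟨.rfind cf, fun p => funext fun n => by simp only [OracleCode.eval, hcf]; rfl⟩

theorem OracleCode.exists_eval_eq_eval_comp (c : OracleCode) {h : ℕ → ℕ} (hh : Computable h) :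
    ∃ c' : OracleCode, ∀ p, c'.eval p = c.eval (p ∘ h) := by
  obtain ⟨ch, hch⟩ := exists_eval_eq_of_partrec (Partrec.nat_iff.1 hh)
  induction c with
  | zero => exact ⟨.zero, fun p => rfl⟩
  | succ => exact ⟨.succ, fun p => rfl⟩
  | left => exact ⟨.left, fun p => rfl⟩
  | right => exact ⟨.right, fun p => rfl⟩
  | oracle => exact ⟨.comp .oracle ch, fun p => funext fun n => by simp [eval, hch]⟩
  | pair _ _ ihf ihg =>
    obtain ⟨cf, hcf⟩ := ihf
    obtain ⟨cg, hcg⟩ := ihg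
    exact ⟨.pair cf cg, fun p => funext fun n => by simp only [eval, hcf, hcg]⟩
  | comp _ _ ihf ihg =>
    obtain ⟨cf, hcf⟩ := ihf
    obtain ⟨cg, hcg⟩ := ihg
    exact ⟨.comp cf cg, fun p => funext fun n => by simp only [eval, hcf, hcg]⟩
  | prec _ _ ihf ihg =>
    obtain ⟨cf, hcf⟩ := ihf
    obtain ⟨cg, hcg⟩ := ihg
    exact ⟨.prec cf cg, fun p => funext fun n => by simp only [eval, hcf, hcg]⟩
  | rfind _ ihf =>
    obtain ⟨cf, hcf⟩ := ihf
    exact ⟨.rfind cf, fun p => funext fun n => by simp only [eval, hcf]⟩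

theorem OracleCode.eval_comp_of_eq_some {c c' : OracleCode} {p : ℕ → ℕ} {a b : ℕ}
    (h : c'.eval p a = Part.some b) : (OracleCode.comp c c').eval p a = c.eval p b := by
  simp [eval, h]

theorem OracleCode.eval_prec_pair {cf cg : OracleCode} {p b : ℕ → ℕ} {a : ℕ}
    (hf : cf.eval p a = Part.some (b 0))
    (hg : ∀ k, cg.eval p (Nat.pair a (Nat.pair k (b k))) = Part.some (b (k + 1))) (k : ℕ) :
    (OracleCode.prec cf cg).eval p (Nat.pair a k) = Part.some (b k) := by
  simp only [eval, Nat.unpair_pair]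
  induction k with
  | zero => exact hf
  | succ k ih => exact (congrArg (Part.bind · _) ih).trans ((Part.bind_some _ _).trans (hg k))

theorem OracleCode.exists_baireComputable (c : OracleCode) :
    ∃ F : (ℕ → ℕ) →. (ℕ → ℕ), BaireComputable F ∧
      ∀ p q, (∀ k, q k ∈ c.eval p k) → q ∈ F p := by
  refine ⟨fun p => ⟨∀ k, (c.eval p k).Dom, fun h k => (c.eval p k).get (h k)⟩,
    ⟨c, fun p q => ⟨?_, ?_⟩⟩, fun p q hq => ⟨fun k => (hq k).1, funext fun k => (hq k).2⟩⟩
  · rintro ⟨h, rfl⟩ k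
    exact ⟨h k, rfl⟩
  · exact fun hq => ⟨fun k => (hq k).1, funext fun k => (hq k).2⟩

section OracleComputability

variable {β γ σ : Type*} [Primcodable β] [Primcodable γ] [Primcodable σ]

/-- A total function of an infinite sequence `p` and a discrete argument is computable if a single
program with oracle `p` computes it, on codes. -/
def OracleComputable (f : (ℕ → ℕ) → β → γ) : Prop :=
  ∃ c : OracleCode, ∀ p b, c.eval p (Encodable.encode b) = Part.some (Encodable.encode (f p b))

namespace OracleComputable

theorem of_computable {g : β → γ} (hg : Computable g) :
    OracleComputable fun _ : ℕ → ℕ => g := by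
  obtain ⟨c, hc⟩ := OracleCode.exists_eval_eq_of_partrec hg
  exact ⟨c, fun p b => by simp [hc]⟩

theorem oracle : OracleComputable fun (p : ℕ → ℕ) (i : ℕ) => p i :=
  ⟨.oracle, fun _ _ => rfl⟩

theorem comp {f : (ℕ → ℕ) → γ → σ} {g : (ℕ → ℕ) → β → γ} (hf : OracleComputable f)
    (hg : OracleComputable g) : OracleComputable fun p b => f p (g p b) := by
  obtain ⟨cf, hcf⟩ := hf
  obtain ⟨cg, hcg⟩ := hg
  exact ⟨.comp cf cg, fun p b => by simp [OracleCode.eval, hcf, hcg]⟩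

theorem pair {f : (ℕ → ℕ) → β → γ} {g : (ℕ → ℕ) → β → σ} (hf : OracleComputable f)
    (hg : OracleComputable g) : OracleComputable fun p b => (f p b, g p b) := by
  obtain ⟨cf, hcf⟩ := hf
  obtain ⟨cg, hcg⟩ := hg
  exact ⟨.pair cf cg, fun p b => by simp [OracleCode.eval, hcf, hcg]⟩

theorem comp_oracle {f : (ℕ → ℕ) → β → γ} (hf : OracleComputable f) {h : ℕ → ℕ}
    (hh : Computable h) : OracleComputable fun p => f (p ∘ h) := by
  obtain ⟨c, hc⟩ := hf
  obtain ⟨c', hc'⟩ := c.exists_eval_eq_eval_comp hh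
  exact ⟨c', fun p b => by rw [hc', hc]⟩

theorem nat_rec {f : (ℕ → ℕ) → β → γ} {g : (ℕ → ℕ) → β × ℕ × γ → γ} (hf : OracleComputable f)
    (hg : OracleComputable g) : OracleComputable fun p (t : β × ℕ) =>
      (Nat.rec (f p t.1) (fun m a => g p (t.1, m, a)) t.2 : γ) := by
  obtain ⟨cf, hcf⟩ := hf
  obtain ⟨cg, hcg⟩ := hg
  refine ⟨.prec cf cg, fun p ⟨b, m⟩ => ?_⟩
  exact OracleCode.eval_prec_pair
    (b := fun m => Encodable.encode (Nat.rec (f p b) (fun m a => g p (b, m, a)) m : γ))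
    (hcf p b) (fun k => hcg p (b, k, _)) m

theorem and {f g : (ℕ → ℕ) → β → Bool} (hf : OracleComputable f) (hg : OracleComputable g) :
    OracleComputable fun p b => f p b && g p b :=
  (of_computable (g := fun t : Bool × Bool => t.1 && t.2) Primrec.and.to_comp).comp (hf.pair hg)

theorem or {f g : (ℕ → ℕ) → β → Bool} (hf : OracleComputable f) (hg : OracleComputable g) :
    OracleComputable fun p b => f p b || g p b :=
  (of_computable (g := fun t : Bool × Bool => t.1 || t.2) Primrec.or.to_comp).comp (hf.pair hg)

theorem not {f : (ℕ → ℕ) → β → Bool} (hf : OracleComputable f) :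
    OracleComputable fun p b => !f p b :=
  (of_computable Primrec.not.to_comp).comp hf

theorem decide_exists_lt {f : (ℕ → ℕ) → β × ℕ → Bool} (hf : OracleComputable f) :
    OracleComputable fun p (t : β × ℕ) => decide (∃ m < t.2, f p (t.1, m) = true) := by
  have hstep : OracleComputable fun p (t : β × ℕ × Bool) => t.2.2 || f p (t.1, t.2.1) :=
    (of_computable (Computable.snd.comp Computable.snd)).or
      (hf.comp (of_computable (Computable.fst.pair (Computable.fst.comp Computable.snd))))
  obtain ⟨c, hc⟩ := (of_computable (Computable.const (α := β) false)).nat_rec hstep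
  refine ⟨c, fun p ⟨b, n⟩ => (hc p (b, n)).trans ?_⟩
  congr 2
  induction n with
  | zero => simp
  | succ n ih => grind

theorem decide_forall_lt {f : (ℕ → ℕ) → β × ℕ → Bool} (hf : OracleComputable f) :
    OracleComputable fun p (t : β × ℕ) => decide (∀ m < t.2, f p (t.1, m) = true) := by
  obtain ⟨c, hc⟩ := hf.not.decide_exists_lt.not
  exact ⟨c, fun p t => (hc p t).trans (by simp [← decide_not])⟩

end OracleComputable

end OracleComputability

section Semidecidability

variable {Z Z' : Type*} {β γ : Type*} [Primcodable β] [Primcodable γ]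
  {N : (ℕ → ℕ) → Z → Prop} {N' : (ℕ → ℕ) → Z' → Prop}

/-- A property of `z : Z` and a discrete parameter is semidecidable, relative to a relation
`N p z` saying that `p` names `z`, if one program verifies it: the property holds iff some witness
`w` passes a test that is computable from any name of `z`. -/
def SemidecidableOn (N : (ℕ → ℕ) → Z → Prop) (P : Z → β → Prop) : Prop :=
  ∃ Q : (ℕ → ℕ) → β × ℕ → Bool, OracleComputable Q ∧
    ∀ p z, N p z → ∀ b, P z b ↔ ∃ w, Q p (b, w) = true

namespace SemidecidableOn

theorem of_computablePred {P : β → Prop} (hP : ComputablePred P) :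
    SemidecidableOn N fun _ => P := by
  obtain ⟨_, hP⟩ := hP
  exact ⟨fun _ t => decide (P t.1), .of_computable (hP.comp Computable.fst), by simp⟩

theorem comp_of_iff {P : Z → β → Prop} {P' : Z' → γ → Prop} {h : ℕ → ℕ}
    {g : (ℕ → ℕ) → γ → β} (hP : SemidecidableOn N P) (hh : Computable h) (hg : OracleComputable g)
    (hiff : ∀ p z', N' p z' → ∃ z, N (p ∘ h) z ∧ ∀ c, P' z' c ↔ P z (g p c)) :
    SemidecidableOn N' P' := by
  obtain ⟨Q, hQ, hPQ⟩ := hP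
  refine ⟨fun p t => Q (p ∘ h) (g p t.1, t.2), (hQ.comp_oracle hh).comp
    ((hg.comp (.of_computable Computable.fst)).pair (.of_computable Computable.snd)), ?_⟩
  intro p z' hz' c
  obtain ⟨z, hz, hiff⟩ := hiff p z' hz'
  rw [hiff, hPQ _ _ hz]

theorem comp {P : Z → β → Prop} (hP : SemidecidableOn N P) {g : γ → β} (hg : Computable g) :
    SemidecidableOn N fun z c => P z (g c) :=
  hP.comp_of_iff Computable.id (.of_computable hg) fun _ z hz => ⟨z, hz, fun _ => Iff.rfl⟩

theorem and {P P' : Z → β → Prop} (hP : SemidecidableOn N P) (hP' : SemidecidableOn N P') :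
    SemidecidableOn N fun z b => P z b ∧ P' z b := by
  obtain ⟨Q, hQ, hPQ⟩ := hP
  obtain ⟨Q', hQ', hPQ'⟩ := hP'
  refine ⟨fun p t => Q p (t.1, t.2.unpair.1) && Q' p (t.1, t.2.unpair.2),
    .and (hQ.comp (.of_computable ?_)) (hQ'.comp (.of_computable ?_)), fun p z hz b => ?_⟩
  · exact Computable.fst.pair (Computable.fst.comp (Computable.unpair.comp Computable.snd))
  · exact Computable.fst.pair (Computable.snd.comp (Computable.unpair.comp Computable.snd))
  · simp only [hPQ p z hz, hPQ' p z hz, Bool.and_eq_true]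
    exact ⟨fun ⟨⟨v, hv⟩, w, hw⟩ => ⟨Nat.pair v w, by simp [hv, hw]⟩,
      fun ⟨w, hv, hw⟩ => ⟨⟨_, hv⟩, _, hw⟩⟩

theorem or {P P' : Z → β → Prop} (hP : SemidecidableOn N P) (hP' : SemidecidableOn N P') :
    SemidecidableOn N fun z b => P z b ∨ P' z b := by
  obtain ⟨Q, hQ, hPQ⟩ := hP
  obtain ⟨Q', hQ', hPQ'⟩ := hP'
  refine ⟨fun p t => Q p t || Q' p t, hQ.or hQ', fun p z hz b => ?_⟩
  simp only [hPQ p z hz, hPQ' p z hz, Bool.or_eq_true, exists_or]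

theorem exists_nat {P : Z → β × ℕ → Prop} (hP : SemidecidableOn N P) :
    SemidecidableOn N fun z b => ∃ m, P z (b, m) := by
  obtain ⟨Q, hQ, hPQ⟩ := hP
  refine ⟨fun p t => Q p ((t.1, t.2.unpair.1), t.2.unpair.2),
    hQ.comp (.of_computable ((Computable.fst.pair ?_).pair ?_)), fun p z hz b => ?_⟩
  · exact Computable.fst.comp (Computable.unpair.comp Computable.snd)
  · exact Computable.snd.comp (Computable.unpair.comp Computable.snd)
  · simp only [hPQ p z hz]
    exact ⟨fun ⟨m, w, h⟩ => ⟨Nat.pair m w, by simpa using h⟩, fun ⟨w, h⟩ => ⟨_, _, h⟩⟩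

theorem forall_lt {P : Z → β × ℕ → Prop} (hP : SemidecidableOn N P) {f : β → ℕ}
    (hf : Computable f) : SemidecidableOn N fun z b => ∀ m < f b, P z (b, m) := by
  obtain ⟨Q, hQ, hPQ⟩ := hP
  have hswap : Computable fun t : (β × ℕ) × ℕ => ((t.1.1, t.2), t.1.2) :=
    ((Computable.fst.comp Computable.fst).pair Computable.snd).pair
      (Computable.snd.comp Computable.fst)
  refine ⟨fun p t => decide (∀ m < f t.1, decide (∃ w < t.2, Q p ((t.1, m), w)) = true),
    (hQ.decide_exists_lt.comp (.of_computable hswap)).decide_forall_lt.comp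
      (.of_computable (Computable.id.pair (hf.comp Computable.fst))), fun p z hz b => ?_⟩
  simp only [hPQ p z hz, decide_eq_true_eq]
  constructor
  · intro h
    choose! w hw using h
    obtain ⟨W, hW⟩ := ((Finset.range (f b)).image w).bddAbove
    refine ⟨W + 1, fun m hm => ⟨w m, Nat.lt_succ_of_le (hW ?_), hw m hm⟩⟩
    exact Finset.mem_coe.2 (Finset.mem_image_of_mem w (Finset.mem_range.2 hm))
  · rintro ⟨W, hW⟩ m hm
    obtain ⟨w, -, hw⟩ := hW m hm
    exact ⟨w, hw⟩

theorem exists_selector {P : Z → β × ℕ → Prop} (hP : SemidecidableOn N P) :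
    ∃ c : OracleCode, ∀ p z, N p z → ∀ b, (∃ m, P z (b, m)) →
      ∃ m, P z (b, m) ∧ c.eval p (Encodable.encode b) = Part.some m := by
  obtain ⟨Q, hQ, hPQ⟩ := hP
  have hunpair : Computable fun t : β × ℕ => ((t.1, t.2.unpair.1), t.2.unpair.2) :=
    (Computable.fst.pair (Computable.fst.comp (Computable.unpair.comp Computable.snd))).pair
      (Computable.snd.comp (Computable.unpair.comp Computable.snd))
  obtain ⟨test, htest⟩ := (OracleComputable.of_computable
    (Computable.cond Computable.id (Computable.const 0) (Computable.const 1))).comp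
      (hQ.comp (.of_computable hunpair))
  refine ⟨.comp .left (.rfind test), fun p z hz b hb => ?_⟩
  have hex : ∃ t : ℕ, Q p ((b, t.unpair.1), t.unpair.2) = true := by
    obtain ⟨m, hm⟩ := hb
    obtain ⟨w, hw⟩ := (hPQ p z hz _).1 hm
    exact ⟨Nat.pair m w, by simpa using hw⟩
  have htest' : ∀ t, test.eval p (Nat.pair (Encodable.encode b) t) =
      Part.some (cond (Q p ((b, t.unpair.1), t.unpair.2)) 0 1) := fun t => htest p (b, t)
  have hfind : (OracleCode.rfind test).eval p (Encodable.encode b) = Part.some (Nat.find hex) := by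
    refine Part.eq_some_iff.2 (Nat.mem_rfind.2 ⟨?_, fun {t} ht => ?_⟩)
    · simp [htest', Nat.find_spec hex]
    · simp [htest', Nat.find_min hex ht]
  exact ⟨_, (hPQ p z hz _).2 ⟨_, Nat.find_spec hex⟩, OracleCode.eval_comp_of_eq_some hfind⟩

theorem exists_chain_code {S R : Z → ℕ × ℕ → Prop} (hS : SemidecidableOn N S)
    (hR : SemidecidableOn N R) :
    ∃ c : OracleCode, ∀ p z, N p z → (∃ b, S z (0, b)) →
      (∀ k b, S z (k, b) → ∃ b', S z (k + 1, b') ∧ R z (b, b')) →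
      ∃ b : ℕ → ℕ, (∀ k, S z (k, b k)) ∧ (∀ k, R z (b k, b (k + 1))) ∧
        ∀ k, c.eval p k = Part.some (b k) := by
  have hfirst : SemidecidableOn N fun z (t : ℕ × ℕ) => S z (0, t.2) :=
    hS.comp ((Computable.const 0).pair Computable.snd)
  have hnext : SemidecidableOn N fun z (t : (ℕ × ℕ × ℕ) × ℕ) =>
      S z (t.1.2.1 + 1, t.2) ∧ R z (t.1.2.2, t.2) := by
    refine (hS.comp (.pair ?_ .snd)).and (hR.comp (.pair ?_ .snd))
    · exact Computable.succ.comp (Computable.fst.comp (Computable.snd.comp Computable.fst))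
    · exact Computable.snd.comp (Computable.snd.comp Computable.fst)
  obtain ⟨first, hfirst⟩ := hfirst.exists_selector
  obtain ⟨next, hnext⟩ := hnext.exists_selector
  obtain ⟨arg, harg⟩ := OracleComputable.of_computable
    (Primrec₂.natPair.comp (Primrec.const 0) Primrec.id).to_comp
  refine ⟨.comp (.prec first next) arg, fun p z hz hstart hsucc => ?_⟩
  obtain ⟨b₀, hb₀, hfirst⟩ := hfirst p z hz 0 hstart
  choose! s hs hnext using fun k b (h : S z (k, b)) => hnext p z hz (0, k, b) (hsucc k b h)
  let b : ℕ → ℕ := fun k => Nat.rec b₀ s k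
  have hb : ∀ k, S z (k, b k) := fun k => by
    induction k with
    | zero => exact hb₀
    | succ k ih => exact (hs k _ ih).1
  have harg : ∀ k, arg.eval p k = Part.some (Nat.pair 0 k) := harg p
  refine ⟨b, hb, fun k => (hs k _ (hb k)).2, fun k => ?_⟩
  rw [OracleCode.eval_comp_of_eq_some (harg k)]
  exact OracleCode.eval_prec_pair hfirst (fun k => hnext k _ (hb k)) k

theorem exists_baireComputable_chain {S R : Z → ℕ × ℕ → Prop} (hS : SemidecidableOn N S)
    (hR : SemidecidableOn N R) {out : ℕ → ℕ} (hout : Computable out) :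
    ∃ F : (ℕ → ℕ) →. (ℕ → ℕ), BaireComputable F ∧ ∀ p z, N p z → (∃ b, S z (0, b)) →
      (∀ k b, S z (k, b) → ∃ b', S z (k + 1, b') ∧ R z (b, b')) →
      ∃ b : ℕ → ℕ, (∀ k, S z (k, b k)) ∧ (∀ k, R z (b k, b (k + 1))) ∧
        (fun k => out (b k)) ∈ F p := by
  obtain ⟨chain, hchain⟩ := hS.exists_chain_code hR
  obtain ⟨c, hc⟩ := OracleComputable.of_computable hout
  obtain ⟨F, hF, hFc⟩ := OracleCode.exists_baireComputable (.comp c chain)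
  refine ⟨F, hF, fun p z hz hstart hsucc => ?_⟩
  obtain ⟨b, hb, hbb, heval⟩ := hchain p z hz hstart hsucc
  have hc : ∀ k, c.eval p (b k) = Part.some (out (b k)) := fun k => hc p (b k)
  exact ⟨b, hb, hbb, hFc p _ fun k => by
    simp [OracleCode.eval_comp_of_eq_some (heval k), hc]⟩

end SemidecidableOn

end Semidecidability

section ComputableRationals

variable {β γ : Type*} [Primcodable β] [Primcodable γ] {f g : β → ℕ} {u v : β → ℚ}

theorem computable_nat_add (hf : Computable f) (hg : Computable g) :
    Computable fun b => f b + g b :=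
  Primrec.nat_add.to_comp.comp hf hg

theorem computable_nat_mul (hf : Computable f) (hg : Computable g) :
    Computable fun b => f b * g b :=
  Primrec.nat_mul.to_comp.comp hf hg

theorem computable_two_mul : Computable fun i : ℕ => 2 * i :=
  computable_nat_mul (.const 2) .id

theorem computable_nat_pow (hf : Computable f) (hg : Computable g) :
    Computable fun b => f b ^ g b := by
  refine (Computable.nat_rec hg (Computable.const 1) (h := fun b t => t.2 * f b)
    (computable_nat_mul (Computable.snd.comp Computable.snd) (hf.comp Computable.fst))).of_eq ?_
  intro b
  induction g b with
  | zero => rfl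
  | succ m ih => exact (congrArg (· * f b) ih).trans (pow_succ _ _).symm

/-- A rational-valued function of a discrete argument is computable. For `β = ℕ` this is
`IsComputableRatSeq`. -/
def ComputableRat (u : β → ℚ) : Prop :=
  ∃ a b c : β → ℕ, Computable a ∧ Computable b ∧ Computable c ∧
    ∀ t, u t = ((a t : ℚ) - (b t : ℚ)) / ((c t : ℚ) + 1)

namespace ComputableRat

theorem comp {u : γ → ℚ} (hu : ComputableRat u) {f : β → γ} (hf : Computable f) :
    ComputableRat fun t => u (f t) := by
  obtain ⟨a, b, c, ha, hb, hc, h⟩ := hu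
  exact ⟨_, _, _, ha.comp hf, hb.comp hf, hc.comp hf, fun t => h (f t)⟩

theorem natCast (hf : Computable f) : ComputableRat fun t => (f t : ℚ) :=
  ⟨f, fun _ => 0, fun _ => 0, hf, .const 0, .const 0, fun t => by simp⟩

theorem natCast_inv (hf : Computable f) : ComputableRat fun t => (f t : ℚ)⁻¹ := by
  refine ⟨fun _ => 1, fun t => 1 - f t, fun t => f t - 1, .const 1,
    Primrec.nat_sub.to_comp.comp (.const 1) hf, Primrec.nat_sub.to_comp.comp hf (.const 1), ?_⟩
  intro t
  beta_reduce
  cases f t <;> simp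

theorem neg (hu : ComputableRat u) : ComputableRat fun t => -u t := by
  obtain ⟨a, b, c, ha, hb, hc, h⟩ := hu
  exact ⟨b, a, c, hb, ha, hc, fun t => by simp only [h]; ring⟩

theorem const (q : ℚ) : ComputableRat fun _ : β => q :=
  ⟨fun _ => q.num.toNat, fun _ => (-q.num).toNat, fun _ => q.den - 1, .const _, .const _,
    .const _, fun _ => by
      have hnum : ((q.num.toNat : ℚ) - ((-q.num).toNat : ℚ)) = q.num := by
        exact_mod_cast Int.toNat_sub_toNat_neg q.num
      have hden : ((q.den - 1 : ℕ) : ℚ) + 1 = q.den := by exact_mod_cast Nat.sub_add_cancel q.pos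
      rw [hnum, hden, Rat.num_div_den]⟩

theorem add (hu : ComputableRat u) (hv : ComputableRat v) :
    ComputableRat fun t => u t + v t := by
  obtain ⟨a, b, c, ha, hb, hc, h⟩ := hu
  obtain ⟨a', b', c', ha', hb', hc', h'⟩ := hv
  have hc1 : Computable fun t => c t + 1 := Computable.succ.comp hc
  have hc1' : Computable fun t => c' t + 1 := Computable.succ.comp hc'
  refine ⟨_, _, _,
    computable_nat_add (computable_nat_mul ha hc1') (computable_nat_mul ha' hc1),
    computable_nat_add (computable_nat_mul hb hc1') (computable_nat_mul hb' hc1),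
    computable_nat_add (computable_nat_mul hc hc1') hc', fun t => ?_⟩
  have hden : ((c t : ℚ) * (c' t + 1) + c' t + 1) ≠ 0 := by positivity
  simp only [h, h']
  push_cast
  field_simp
  ring

theorem mul (hu : ComputableRat u) (hv : ComputableRat v) :
    ComputableRat fun t => u t * v t := by
  obtain ⟨a, b, c, ha, hb, hc, h⟩ := hu
  obtain ⟨a', b', c', ha', hb', hc', h'⟩ := hv
  refine ⟨_, _, _,
    computable_nat_add (computable_nat_mul ha ha') (computable_nat_mul hb hb'),
    computable_nat_add (computable_nat_mul ha hb') (computable_nat_mul hb ha'),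
    computable_nat_add (computable_nat_mul hc (Computable.succ.comp hc')) hc', fun t => ?_⟩
  have hden : ((c t : ℚ) * (c' t + 1) + c' t + 1) ≠ 0 := by positivity
  simp only [h, h']
  push_cast
  field_simp
  ring

theorem sub (hu : ComputableRat u) (hv : ComputableRat v) :
    ComputableRat fun t => u t - v t := by
  simpa only [sub_eq_add_neg] using hu.add hv.neg

theorem sum {n : ℕ} {u : Fin n → β → ℚ} (hu : ∀ i, ComputableRat (u i)) :
    ComputableRat fun t => ∑ i, u i t := by
  induction n with
  | zero => simpa using const (β := β) 0
  | succ n ih => simpa only [Fin.sum_univ_succ] using (hu 0).add (ih fun i => hu i.succ)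

theorem lt (hu : ComputableRat u) (hv : ComputableRat v) :
    ComputablePred fun t => u t < v t := by
  obtain ⟨a, b, c, ha, hb, -, h⟩ := hu.sub hv
  have hlt : ComputablePred fun t => a t < b t :=
    ComputablePred.computable_iff.2 ⟨_, Primrec.nat_lt.decide.to_comp.comp ha hb, by simp⟩
  refine hlt.of_eq fun t => ?_
  have hden : (0 : ℚ) < c t + 1 := by positivity
  rw [← sub_neg (a := u t), show u t - v t = _ from h t, div_neg_iff]
  simp [hden, hden.not_gt]

end ComputableRat

/-- An enumeration of all rational numbers, through which programs refer to rationals. -/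
def ratSeq (k : ℕ) : ℚ :=
  ((k.unpair.1 : ℚ) - (k.unpair.2.unpair.1 : ℚ)) / ((k.unpair.2.unpair.2 : ℚ) + 1)

theorem computableRat_ratSeq : ComputableRat ratSeq :=
  ⟨_, _, _, .comp .fst .unpair, .comp .fst (.comp .unpair (.comp .snd .unpair)),
    .comp .snd (.comp .unpair (.comp .snd .unpair)), fun _ => rfl⟩

theorem ComputableRat.exists_eq_ratSeq (hu : ComputableRat u) :
    ∃ f : β → ℕ, Computable f ∧ ∀ t, u t = ratSeq (f t) := by
  obtain ⟨a, b, c, ha, hb, hc, h⟩ := hu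
  exact ⟨fun t => Nat.pair (a t) (Nat.pair (b t) (c t)),
    Primrec₂.natPair.to_comp.comp ha (Primrec₂.natPair.to_comp.comp hb hc),
    fun t => by simp [h, ratSeq]⟩

theorem ratSeq_surjective : Function.Surjective ratSeq := fun q => by
  obtain ⟨f, -, hf⟩ := (ComputableRat.const (β := ℕ) q).exists_eq_ratSeq
  exact ⟨f 0, (hf 0).symm⟩

end ComputableRationals

section SemicomputableReals

variable {Z Z' : Type*} {β γ : Type*} [Primcodable β] [Primcodable γ]
  {N : (ℕ → ℕ) → Z → Prop} {N' : (ℕ → ℕ) → Z' → Prop} {f g : Z → β → ℝ} {u : β → ℚ}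

/-- The rational upper bounds of the real number `f z b` can be enumerated from `b` and any name
of `z`. -/
def UpperSemicomputable (N : (ℕ → ℕ) → Z → Prop) (f : Z → β → ℝ) : Prop :=
  SemidecidableOn N fun z (t : β × ℕ) => f z t.1 < ratSeq t.2

/-- The rational lower bounds of the real number `f z b` can be enumerated from `b` and any name
of `z`. -/
def LowerSemicomputable (N : (ℕ → ℕ) → Z → Prop) (f : Z → β → ℝ) : Prop :=
  SemidecidableOn N fun z (t : β × ℕ) => (ratSeq t.2 : ℝ) < f z t.1

theorem exists_ratSeq_between {a b : ℝ} (h : a < b) : ∃ k, a < ratSeq k ∧ ratSeq k < b := by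
  obtain ⟨q, hq⟩ := exists_rat_btwn h
  obtain ⟨k, rfl⟩ := ratSeq_surjective q
  exact ⟨k, hq⟩

namespace UpperSemicomputable

theorem lt_ratCast (hf : UpperSemicomputable N f) (hu : ComputableRat u) :
    SemidecidableOn N fun z b => f z b < u b := by
  obtain ⟨k, hk, huk⟩ := hu.exists_eq_ratSeq
  have h := SemidecidableOn.comp hf (Computable.id.pair hk)
  simpa only [huk, id] using h

theorem of_computableRat (hu : ComputableRat u) : UpperSemicomputable N fun _ b => (u b : ℝ) := by
  simp only [UpperSemicomputable, Rat.cast_lt]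
  exact .of_computablePred ((hu.comp .fst).lt (computableRat_ratSeq.comp .snd))

theorem comp_of_eq {f' : Z' → γ → ℝ} {h : ℕ → ℕ} {k : (ℕ → ℕ) → γ → β}
    (hf : UpperSemicomputable N f) (hh : Computable h) (hk : OracleComputable k)
    (heq : ∀ p z', N' p z' → ∃ z, N (p ∘ h) z ∧ ∀ c, f' z' c = f z (k p c)) :
    UpperSemicomputable N' f' := by
  refine SemidecidableOn.comp_of_iff hf hh
    ((hk.comp (.of_computable .fst)).pair (.of_computable .snd)) fun p z' hz' => ?_
  obtain ⟨z, hz, heq⟩ := heq p z' hz'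
  exact ⟨z, hz, fun c => by rw [heq]⟩

theorem comp (hf : UpperSemicomputable N f) {k : γ → β} (hk : Computable k) :
    UpperSemicomputable N fun z c => f z (k c) :=
  hf.comp_of_eq .id (.of_computable hk) fun _ z hz => ⟨z, hz, fun _ => rfl⟩

theorem lt (hf : UpperSemicomputable N f) (hg : LowerSemicomputable N g) :
    SemidecidableOn N fun z b => f z b < g z b := by
  have h := (SemidecidableOn.and hf hg).exists_nat
  have hbetween : ∀ a b : ℝ, (∃ k, a < ratSeq k ∧ ratSeq k < b) ↔ a < b := fun _ _ =>
    ⟨fun ⟨_, h₁, h₂⟩ => h₁.trans h₂, exists_ratSeq_between⟩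
  simpa only [hbetween] using h

theorem add (hf : UpperSemicomputable N f) (hg : UpperSemicomputable N g) :
    UpperSemicomputable N fun z b => f z b + g z b := by
  have hsplit : ∀ a b q : ℝ, a + b < q ↔ ∃ k, a < ratSeq k ∧ b < q - ratSeq k := fun a b q =>
    ⟨fun h => (exists_ratSeq_between (lt_sub_iff_add_lt.2 h)).imp fun k hk =>
      ⟨hk.1, lt_sub_comm.1 hk.2⟩, fun ⟨k, h₁, h₂⟩ => by linarith⟩
  have hfst : Computable fun t : (β × ℕ) × ℕ => t.1.1 := Computable.fst.comp .fst
  have h := (((hf.comp hfst).lt_ratCast (computableRat_ratSeq.comp .snd)).and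
    ((hg.comp hfst).lt_ratCast ((computableRat_ratSeq.comp (.comp .snd .fst)).sub
      (computableRat_ratSeq.comp .snd)))).exists_nat
  simpa only [UpperSemicomputable, hsplit, Rat.cast_sub] using h

end UpperSemicomputable

namespace LowerSemicomputable

theorem ratCast_lt (hf : LowerSemicomputable N f) (hu : ComputableRat u) :
    SemidecidableOn N fun z b => (u b : ℝ) < f z b := by
  obtain ⟨k, hk, huk⟩ := hu.exists_eq_ratSeq
  have h := SemidecidableOn.comp hf (Computable.id.pair hk)
  simpa only [huk, id] using h

theorem comp (hf : LowerSemicomputable N f) {k : γ → β} (hk : Computable k) :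
    LowerSemicomputable N fun z c => f z (k c) := by
  have h := SemidecidableOn.comp hf ((hk.comp .fst).pair (.snd : Computable fun t : γ × ℕ => t.2))
  exact h

theorem const_mul (hf : LowerSemicomputable N f) {c : ℚ} (hc : 0 < c) :
    LowerSemicomputable N fun z b => (c : ℝ) * f z b := by
  have h := (hf.comp .fst).ratCast_lt (computableRat_ratSeq.comp .snd |>.mul (.const c⁻¹))
  have hc' : (0 : ℝ) < c := Rat.cast_pos.2 hc
  simpa only [LowerSemicomputable, Rat.cast_mul, Rat.cast_inv, mul_inv_lt_iff₀' hc'] using h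

end LowerSemicomputable

end SemicomputableReals

section ProjectionBalls

variable {X : Type*} [PseudoMetricSpace X] {A : Set X} {x a : X} {c ρ : ℝ}

/-- The ball around `a` of radius `ρ` meets `A` and has room for a `c`-approximate projection of `x`
onto `A`: either all exact projections of `x` lie inside it, or all of its points are closer to `x`
than `c * infDist x A`. Both alternatives are strict inequalities, so that they can be recognized
by a finite computation, although which of them holds cannot be decided. -/
structure IsProjectionBall (c : ℝ) (A : Set X) (x a : X) (ρ : ℝ) : Prop where
  nonempty : (Metric.ball a ρ ∩ A).Nonempty
  bound : dist x a + Metric.infDist x A < ρ ∨ dist x a + ρ < c * Metric.infDist x A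

namespace IsProjectionBall

theorem self_infDist_add_one (hA : A.Nonempty) :
    IsProjectionBall c A x x (Metric.infDist x A + 1) := by
  obtain ⟨y, hy, hxy⟩ := (Metric.infDist_lt_iff hA).1 (lt_add_one (Metric.infDist x A))
  exact ⟨⟨y, Metric.mem_ball'.2 hxy, hy⟩, .inl (by simp)⟩

theorem radius_pos (h : IsProjectionBall c A x a ρ) : 0 < ρ :=
  Metric.nonempty_ball.1 h.nonempty.left

theorem dist_le (h : IsProjectionBall c A x a ρ) (hc : 0 ≤ c) :
    dist x a ≤ c * Metric.infDist x A + ρ := by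
  have hρ := h.radius_pos
  have hD : 0 ≤ Metric.infDist x A := Metric.infDist_nonneg
  have hcD : 0 ≤ c * Metric.infDist x A := mul_nonneg hc hD
  rcases h.bound with h | h <;> linarith

theorem exists_mem_ball (h : IsProjectionBall c A x a ρ) (hA : IsClosed A) (hc : 1 < c) :
    ∃ z ∈ Metric.ball a ρ ∩ A, z = x ∨ dist x z < c * Metric.infDist x A := by
  have hne : A.Nonempty := h.nonempty.right
  obtain ⟨z, hza, hz⟩ := h.nonempty
  rw [Metric.mem_ball'] at hza
  rcases h.bound with hin | hnear
  · rcases Metric.infDist_nonneg.eq_or_lt' (a := Metric.infDist x A) with hD | hD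
    · rw [hD, add_zero] at hin
      exact ⟨x, ⟨hin, (hA.mem_iff_infDist_zero hne).2 hD⟩, .inl rfl⟩
    · obtain ⟨y, hy, hxy⟩ := (Metric.infDist_lt_iff hne).1
        (lt_min (lt_mul_of_one_lt_left hD hc) (lt_sub_iff_add_lt'.2 hin))
      refine ⟨y, ⟨?_, hy⟩, .inr (hxy.trans_le (min_le_left _ _))⟩
      have := dist_triangle y x a
      rw [dist_comm y x] at this
      exact Metric.mem_ball.2 (by linarith [hxy.trans_le (min_le_right _ _)])
  · exact ⟨z, ⟨Metric.mem_ball'.2 hza, hz⟩, .inr (by linarith [dist_triangle x a z])⟩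

theorem exists_of_mem {z : X} (hz : z ∈ A) (hzx : z = x ∨ dist x z < c * Metric.infDist x A) :
    ∃ η > 0, ∀ a ρ, dist z a < ρ → ρ < η → IsProjectionBall c A x a ρ := by
  rcases hzx with rfl | hzx
  · refine ⟨1, one_pos, fun a ρ ha _ => ⟨⟨z, ha, hz⟩, .inl ?_⟩⟩
    rwa [Metric.infDist_zero_of_mem hz, add_zero]
  · refine ⟨(c * Metric.infDist x A - dist x z) / 2, by linarith, fun a ρ ha hρ =>
      ⟨⟨z, ha, hz⟩, .inr ?_⟩⟩
    linarith [dist_triangle x z a]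

theorem exists_limit [CompleteSpace X] {a : ℕ → X} {ρ : ℕ → ℝ}
    (h : ∀ k, IsProjectionBall c A x (a k) (ρ k)) (hA : IsClosed A) (hc : 0 ≤ c)
    (hρ : ∀ k, ρ k < 2⁻¹ ^ k) (hnest : ∀ k, dist (a k) (a (k + 1)) + ρ (k + 1) < ρ k) :
    (∀ i j, i ≤ j → dist (a i) (a j) ≤ 2⁻¹ ^ i) ∧
      ∃ y ∈ A, dist x y ≤ c * Metric.infDist x A ∧ Tendsto a atTop (𝓝 y) := by
  have hchain : ∀ i j, i ≤ j → dist (a i) (a j) + ρ j ≤ ρ i := fun i j hij => by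
    induction j, hij using Nat.le_induction with
    | base => simp
    | succ j _ ih => linarith [dist_triangle (a i) (a j) (a (j + 1)), hnest j]
  have hpow : Tendsto (fun k : ℕ => (2⁻¹ : ℝ) ^ k) atTop (𝓝 0) :=
    tendsto_pow_atTop_nhds_zero_of_lt_one (by norm_num) (by norm_num)
  have hρ₀ : Tendsto ρ atTop (𝓝 0) :=
    squeeze_zero (fun k => (h k).radius_pos.le) (fun k => (hρ k).le) hpow
  have hcauchy : ∀ i j, i ≤ j → dist (a i) (a j) ≤ 2⁻¹ ^ i := fun i j hij => by
    linarith [hchain i j hij, hρ i, (h j).radius_pos]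
  obtain ⟨y, hy⟩ := cauchySeq_tendsto_of_complete (cauchySeq_of_le_tendsto_0' _ hcauchy hpow)
  refine ⟨hcauchy, y, ?_, ?_, hy⟩
  · choose z hza hz using fun k => (h k).nonempty
    refine hA.mem_of_tendsto (hy.congr_dist ?_) (.of_forall hz)
    exact squeeze_zero (fun _ => dist_nonneg) (fun k => (Metric.mem_ball'.1 (hza k)).le) hρ₀
  · simpa using le_of_tendsto_of_tendsto' (tendsto_const_nhds.dist hy)
      (tendsto_const_nhds.add hρ₀) fun k => (h k).dist_le hc

end IsProjectionBall

end ProjectionBalls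

section EffectiveMetricSpaces

variable {X : Type*} [MetricSpace X] {α : ℕ → X} {r : ℕ → ℚ}

theorem exists_mem_basicBall (hα : DenseRange α) (hr : Set.range r = {s | 0 ≤ s}) (z : X)
    {η : ℝ} (hη : 0 < η) : ∃ k : ℕ, z ∈ basicBall α r k ∧ r k.unpair.2 < η := by
  obtain ⟨s, hs₀, hs⟩ := exists_rat_btwn hη
  obtain ⟨m, hm⟩ : s ∈ Set.range r := by
    rw [hr]
    exact Rat.cast_nonneg.1 hs₀.le
  obtain ⟨i, hi⟩ := hα.exists_dist_lt z hs₀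
  exact ⟨Nat.pair i m, by simpa [basicBall, hm] using hi, by simpa [hm] using hs⟩

theorem IsProjectionBall.exists_basicBall {A : Set X} {x a : X} {c ρ η : ℝ}
    (h : IsProjectionBall c A x a ρ) (hA : IsClosed A) (hc : 1 < c) (hα : DenseRange α)
    (hr : Set.range r = {s | 0 ≤ s}) (hη : 0 < η) :
    ∃ k : ℕ, IsProjectionBall c A x (α k.unpair.1) (r k.unpair.2) ∧ r k.unpair.2 < η ∧
      dist a (α k.unpair.1) + r k.unpair.2 < ρ := by
  obtain ⟨z, ⟨hza, hz⟩, hzx⟩ := h.exists_mem_ball hA hc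
  rw [Metric.mem_ball'] at hza
  obtain ⟨η', hη', hball⟩ := exists_of_mem hz hzx
  obtain ⟨k, hzk, hk⟩ := exists_mem_basicBall hα hr z
    (lt_min (lt_min hη hη') (half_pos (sub_pos.2 hza)))
  obtain ⟨⟨hkη, hkη'⟩, hkρ⟩ := (lt_min_iff.1 hk).imp_left lt_min_iff.1
  refine ⟨k, hball _ _ hzk hkη', hkη, ?_⟩
  linarith [dist_triangle a z (α k.unpair.1), Metric.mem_ball.1 hzk]

theorem infDist_lt_iff_exists_basicBall (hα : DenseRange α) (hr : Set.range r = {s | 0 ≤ s})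
    {A : Set X} (hA : A.Nonempty) {x : X} {q : ℝ} : Metric.infDist x A < q ↔
      ∃ k : ℕ, (basicBall α r k ∩ A).Nonempty ∧ dist x (α k.unpair.1) + r k.unpair.2 < q := by
  constructor
  · intro h
    obtain ⟨z, hz, hxz⟩ := (Metric.infDist_lt_iff hA).1 h
    obtain ⟨k, hzk, hk⟩ := exists_mem_basicBall hα hr z (half_pos (sub_pos.2 hxz))
    refine ⟨k, ⟨z, hzk, hz⟩, ?_⟩
    linarith [dist_triangle x z (α k.unpair.1), Metric.mem_ball.1 hzk]
  · rintro ⟨k, ⟨z, hzk, hz⟩, hk⟩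
    linarith [dist_triangle x (α k.unpair.1) z, Metric.mem_ball'.1 hzk,
      Metric.infDist_le_dist_of_mem (x := x) hz]

theorem lt_infDist_iff_exists_closedBall (hα : DenseRange α) (hr : Set.range r = {s | 0 ≤ s})
    {A : Set X} (hA : A.Nonempty) {x : X} {q : ℝ} : q < Metric.infDist x A ↔ q < 0 ∨
      ∃ k : ℕ, Disjoint (Metric.closedBall (α k.unpair.1) (r k.unpair.2)) A ∧
        dist x (α k.unpair.1) < r k.unpair.2 - q := by
  constructor
  · refine fun h => (lt_or_ge q 0).imp_right fun hq => ?_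
    obtain ⟨s, hqs, hs⟩ := exists_rat_btwn h
    obtain ⟨m, hm⟩ : s ∈ Set.range r := by
      rw [hr]
      exact Rat.cast_nonneg.1 (hq.trans hqs.le)
    obtain ⟨i, hi⟩ := hα.exists_dist_lt x (lt_min (sub_pos.2 hqs) (sub_pos.2 hs))
    obtain ⟨hiq, his⟩ := lt_min_iff.1 hi
    refine ⟨Nat.pair i m, ?_, by simpa [hm] using hiq⟩
    simp only [Nat.unpair_pair, hm]
    refine Set.disjoint_left.2 fun z hz hzA => ?_
    linarith [dist_triangle x (α i) z, Metric.mem_closedBall'.1 hz,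
      Metric.infDist_le_dist_of_mem (x := x) hzA]
  · rintro (hq | ⟨k, hdisj, hk⟩)
    · exact hq.trans_le Metric.infDist_nonneg
    · refine lt_of_lt_of_le (lt_sub_comm.1 hk) ((Metric.le_infDist hA).2 fun z hz => ?_)
      have hzk := Set.disjoint_right.1 hdisj hz
      rw [Metric.mem_closedBall', not_le] at hzk
      linarith [dist_triangle (α k.unpair.1) x z, dist_comm x (α k.unpair.1)]

theorem disjoint_iff_subset_iUnion_basicBall {p : ℕ → ℕ} {A : Closeds X}
    (hp : IsNegativeName α r p A) {K : Set X} :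
    Disjoint K (A : Set X) ↔ K ⊆ ⋃ h, basicBall α r (p h) := by
  rw [hp, Set.disjoint_compl_right_iff_subset, Set.biUnion_range]

theorem computableRat_two_inv_pow : ComputableRat fun k : ℕ => (2⁻¹ : ℚ) ^ k := by
  have h := ComputableRat.natCast_inv (computable_nat_pow (.const 2) Computable.id)
  simpa using h

theorem upperSemicomputable_dist_of_name
    (hdist : UpperSemicomputable (@Eq (ℕ → ℕ)) fun _ (t : ℕ × ℕ) => dist (α t.1) (α t.2)) :
    UpperSemicomputable (cauchyRep α).IsName fun x j => dist x (α j) := by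
  have happrox : UpperSemicomputable (@Eq (ℕ → ℕ)) fun p (t : (ℕ × ℕ) × ℕ) =>
      dist (α (p t.2)) (α t.1.1) :=
    hdist.comp_of_eq .id ((OracleComputable.oracle.comp (.of_computable .snd)).pair
      (.of_computable (.comp .fst .fst))) fun p _ hp => ⟨p, rfl, fun t => by rw [← hp]⟩
  have hbound := happrox.add (.of_computableRat (computableRat_two_inv_pow.comp .snd))
  have hsearch := (hbound.lt_ratCast (computableRat_ratSeq.comp (.comp .snd .fst))).exists_nat
  refine hsearch.comp_of_iff .id (.of_computable .id) fun p x hx => ⟨p, rfl, fun t => ?_⟩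
  simp only [id, Rat.cast_pow, Rat.cast_inv, Rat.cast_ofNat]
  have hle : ∀ i, dist (α (p i)) x ≤ 2⁻¹ ^ i := fun i =>
    le_of_tendsto (tendsto_const_nhds.dist hx.2) (eventually_atTop.2 ⟨i, hx.1 i⟩)
  have hpow : Tendsto (fun k : ℕ => (2⁻¹ : ℝ) ^ k) atTop (𝓝 0) :=
    tendsto_pow_atTop_nhds_zero_of_lt_one (by norm_num) (by norm_num)
  constructor
  · intro h
    have hlim := (hx.2.dist (tendsto_const_nhds (x := α t.1))).add hpow
    rw [add_zero] at hlim
    exact (hlim.eventually_lt_const h).exists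
  · rintro ⟨i, hi⟩
    linarith [dist_triangle_left x (α t.1) (α (p i)), hle i]

theorem semidecidableOn_basicBall_inter_nonempty :
    SemidecidableOn (totalRep α r).IsName fun A k => (basicBall α r k ∩ (A : Set X)).Nonempty := by
  have heq : ComputablePred fun t : ℕ × ℕ => t.1 = t.2 :=
    ComputablePred.computable_iff.2 ⟨_, Primrec.eq.decide.to_comp, by simp⟩
  have hentry : SemidecidableOn (@Eq (ℕ → ℕ)) fun p (t : ℕ × ℕ) => p (2 * t.2 + 1) = t.1 :=
    (SemidecidableOn.of_computablePred (N := @Eq (ℕ → ℕ)) heq).comp_of_iff .id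
      ((OracleComputable.oracle.comp (.of_computable (Computable.succ.comp
        (computable_two_mul.comp .snd)))).pair (.of_computable .fst))
      fun p _ hp => ⟨p, rfl, fun t => by rw [← hp]⟩
  exact hentry.exists_nat.comp_of_iff .id (.of_computable .id)
    fun p A hA => ⟨p, rfl, fun k => (hA.2 k).symm⟩

/-- The names of the pairs `(x, A)` in the domain of the approximate projection operator. -/
def IsProjectionInput (α : ℕ → X) (r : ℕ → ℚ) (p : ℕ → ℕ) (z : X × Closeds X) : Prop :=
  ((cauchyRep α).prod (totalRep α r)).IsName p z ∧ (z.2 : Set X).Nonempty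

section ProjectionInput

variable (hα : DenseRange α) (hr : IsEffectiveRadiusEnumeration r)
  (hdist : UpperSemicomputable (@Eq (ℕ → ℕ)) fun _ (t : ℕ × ℕ) => dist (α t.1) (α t.2))

include hdist in
theorem upperSemicomputable_dist_fst :
    UpperSemicomputable (IsProjectionInput α r) fun z j => dist z.1 (α j) :=
  (upperSemicomputable_dist_of_name hdist).comp_of_eq computable_two_mul (.of_computable .id)
    fun _ z hz => ⟨z.1, hz.1.1, fun _ => rfl⟩

theorem SemidecidableOn.of_closeds {β : Type*} [Primcodable β] {P : Closeds X → β → Prop}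
    (hP : SemidecidableOn (totalRep α r).IsName P) :
    SemidecidableOn (IsProjectionInput α r) fun z => P z.2 :=
  hP.comp_of_iff (.comp .succ computable_two_mul) (.of_computable .id)
    fun _ z hz => ⟨z.2, hz.1.2, fun _ => Iff.rfl⟩

include hr in
theorem IsEffectiveRadiusEnumeration.computableRat_radius :
    ComputableRat fun k : ℕ => r k.unpair.2 :=
  ComputableRat.comp hr.1 (.comp .snd .unpair)

include hα hr hdist in
theorem upperSemicomputable_infDist {β : Type*} [Primcodable β] :
    UpperSemicomputable (IsProjectionInput α r) fun z (_ : β) =>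
      Metric.infDist z.1 (z.2 : Set X) := by
  have hcenter : Computable fun t : (β × ℕ) × ℕ => t.2.unpair.1 := .comp .fst (.comp .unpair .snd)
  have hbound := (((upperSemicomputable_dist_fst (r := r) hdist).comp hcenter).add
    (.of_computableRat (hr.computableRat_radius.comp .snd))).lt_ratCast
    (computableRat_ratSeq.comp (.comp .snd .fst))
  have hsearch := ((semidecidableOn_basicBall_inter_nonempty.of_closeds.comp .snd).and
    hbound).exists_nat
  exact hsearch.comp_of_iff .id (.of_computable .id) fun p z hz =>
    ⟨z, hz, fun t => infDist_lt_iff_exists_basicBall hα hr.2 hz.2⟩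

variable (hball : SemidecidableOn (totalRep α r).IsName fun A (k : ℕ) =>
  Disjoint (Metric.closedBall (α k.unpair.1) (r k.unpair.2)) (A : Set X))

include hα hr hdist hball in
theorem lowerSemicomputable_infDist {β : Type*} [Primcodable β] :
    LowerSemicomputable (IsProjectionInput α r) fun z (_ : β) =>
      Metric.infDist z.1 (z.2 : Set X) := by
  have hcenter : Computable fun t : (β × ℕ) × ℕ => t.2.unpair.1 := .comp .fst (.comp .unpair .snd)
  have hbound := ((upperSemicomputable_dist_fst (r := r) hdist).comp hcenter).lt_ratCast
    ((hr.computableRat_radius.comp .snd).sub (computableRat_ratSeq.comp (.comp .snd .fst)))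
  have hneg : SemidecidableOn (IsProjectionInput α r) fun _ (t : β × ℕ) => ratSeq t.2 < 0 :=
    .of_computablePred ((computableRat_ratSeq.comp .snd).lt (.const 0))
  have hsearch := hneg.or ((hball.of_closeds.comp .snd).and hbound).exists_nat
  refine hsearch.comp_of_iff .id (.of_computable .id) fun p z hz => ⟨z, hz, fun t => ?_⟩
  simpa only [id, Rat.cast_lt_zero, Rat.cast_sub] using
    lt_infDist_iff_exists_closedBall hα hr.2 hz.2 (q := ratSeq t.2)

include hα hr hdist hball in
theorem semidecidableOn_isProjectionBall {c : ℚ} (hc : 0 < c) :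
    SemidecidableOn (IsProjectionInput α r) fun z (k : ℕ) =>
      IsProjectionBall c (z.2 : Set X) z.1 (α k.unpair.1) (r k.unpair.2) := by
  have hcenter := (upperSemicomputable_dist_fst (r := r) hdist).comp
    (Computable.fst.comp Computable.unpair)
  have hcontains := (hcenter.add (upperSemicomputable_infDist hα hr hdist)).lt_ratCast
    hr.computableRat_radius
  have hnear := (hcenter.add (.of_computableRat hr.computableRat_radius)).lt
    ((lowerSemicomputable_infDist hα hr hdist hball).const_mul hc)
  have h := semidecidableOn_basicBall_inter_nonempty.of_closeds.and (hcontains.or hnear)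
  exact h.comp_of_iff .id (.of_computable .id) fun _ z hz =>
    ⟨z, hz, fun _ => ⟨fun h => ⟨h.1, h.2⟩, fun h => ⟨h.1, h.2⟩⟩⟩

include hα hr hdist hball in
theorem semidecidableOn_isProjectionBall_and_radius_lt {c : ℚ} (hc : 0 < c) :
    SemidecidableOn (IsProjectionInput α r) fun z (t : ℕ × ℕ) =>
      IsProjectionBall c (z.2 : Set X) z.1 (α t.2.unpair.1) (r t.2.unpair.2) ∧
        (r t.2.unpair.2 : ℝ) < 2⁻¹ ^ t.1 := by
  have hsmall : SemidecidableOn (IsProjectionInput α r) fun _ (t : ℕ × ℕ) =>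
      (r t.2.unpair.2 : ℝ) < 2⁻¹ ^ t.1 := by
    simpa only [Rat.cast_pow, Rat.cast_inv, Rat.cast_ofNat] using
      (UpperSemicomputable.of_computableRat (hr.computableRat_radius.comp .snd)).lt_ratCast
        (computableRat_two_inv_pow.comp .fst)
  exact ((semidecidableOn_isProjectionBall hα hr hdist hball hc).comp .snd).and hsmall

include hr hdist in
theorem semidecidableOn_dist_add_radius_lt_radius :
    SemidecidableOn (IsProjectionInput α r) fun _ (t : ℕ × ℕ) =>
      dist (α t.1.unpair.1) (α t.2.unpair.1) + r t.2.unpair.2 < r t.1.unpair.2 := by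
  have hcenters := hdist.comp ((Computable.comp .fst (.comp .unpair .fst)).pair
    (.comp .fst (.comp .unpair (.snd : Computable fun t : ℕ × ℕ => t.2))))
  exact ((hcenters.add (.of_computableRat (hr.computableRat_radius.comp .snd))).lt_ratCast
    (hr.computableRat_radius.comp .fst)).comp_of_iff .id (.of_computable .id)
      fun p _ _ => ⟨p, rfl, fun _ => Iff.rfl⟩

include hα hr hdist hball in
theorem computableMultimap_approxProjection [CompleteSpace X] {ε : ℝ} (hε : 0 < ε) :
    ComputableMultimap ((cauchyRep α).prod (totalRep α r)) (cauchyRep α)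
      (approxProjection X ε) := by
  obtain ⟨c, hc, hcε⟩ := exists_rat_btwn (lt_add_of_pos_right 1 hε)
  have hc₀ : (0 : ℝ) < c := one_pos.trans hc
  obtain ⟨F, hF, hFchain⟩ := (semidecidableOn_isProjectionBall_and_radius_lt hα hr hdist hball
    (Rat.cast_pos.1 hc₀)).exists_baireComputable_chain
      (semidecidableOn_dist_add_radius_lt_radius hr hdist)
      (out := fun k => k.unpair.1) (.comp .fst .unpair)
  refine ⟨F, hF, fun p z hz hne => ?_⟩
  have hnext : ∀ {a ρ} (k : ℕ), IsProjectionBall c z.2 z.1 a ρ → ∃ b : ℕ,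
      (IsProjectionBall c z.2 z.1 (α b.unpair.1) (r b.unpair.2) ∧
        (r b.unpair.2 : ℝ) < 2⁻¹ ^ k) ∧ dist a (α b.unpair.1) + r b.unpair.2 < ρ := fun k h => by
    simpa only [and_assoc] using
      h.exists_basicBall z.2.isClosed hc hα hr.2 (η := 2⁻¹ ^ k) (by positivity)
  obtain ⟨b, hb, hbb, hout⟩ := hFchain p z ⟨hz, hne⟩
    ((hnext 0 (.self_infDist_add_one hne)).imp fun _ h => h.1) fun k b h => hnext (k + 1) h.1
  obtain ⟨hcauchy, y, hy, hzy, hlim⟩ := IsProjectionBall.exists_limit (fun k => (hb k).1)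
    z.2.isClosed hc₀.le (fun k => (hb k).2) hbb
  exact ⟨_, hout, y, ⟨hy, hzy.trans (mul_le_mul_of_nonneg_right hcε.le Metric.infDist_nonneg)⟩,
    hcauchy, hlim⟩

end ProjectionInput

end EffectiveMetricSpaces

section CoveringClosedBalls

variable {ι κ : Type*}

theorem exists_forall_mem_dist_add_lt_of_isCompact {X : Type*} [PseudoMetricSpace X] {K : Set X}
    (hK : IsCompact K) {a : ι → X} {ρ : ι → ℝ} (hcover : K ⊆ ⋃ i, Metric.ball (a i) (ρ i)) :
    ∃ δ > 0, ∀ w ∈ K, ∃ i, dist w (a i) + δ < ρ i := by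
  refine hK.induction_on ⟨1, one_pos, by simp⟩ ?_ ?_ fun w hw => ?_
  · rintro s t hst ⟨δ, hδ, ht⟩
    exact ⟨δ, hδ, fun w hw => ht w (hst hw)⟩
  · rintro s t ⟨δ, hδ, hs⟩ ⟨δ', hδ', ht⟩
    refine ⟨min δ δ', lt_min hδ hδ', fun w hw => ?_⟩
    rcases hw with hw | hw
    · exact (hs w hw).imp fun i hi => by linarith [min_le_left δ δ']
    · exact (ht w hw).imp fun i hi => by linarith [min_le_right δ δ']
  · obtain ⟨i, hi⟩ := Set.mem_iUnion.1 (hcover hw)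
    obtain ⟨δ, hδ, hδi⟩ := exists_between (sub_pos.2 (Metric.mem_ball.1 hi))
    refine ⟨{w | dist w (a i) + δ < ρ i}, mem_nhdsWithin_of_mem_nhds
      ((isOpen_lt (by fun_prop) (by fun_prop)).mem_nhds ?_), δ, hδ, fun w hw => ⟨i, hw⟩⟩
    exact lt_sub_iff_add_lt'.1 hδi

theorem closedBall_subset_iUnion_ball_of_net {X : Type*} [PseudoMetricSpace X] {a : ι → X}
    {ρ : ι → ℝ} {u : X} {R η : ℝ} {g : κ → X}
    (hnet : ∀ z ∈ Metric.closedBall u R, ∃ m, dist z (g m) ≤ η)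
    (hg : ∀ m, R + η < dist (g m) u ∨ ∃ i, dist (g m) (a i) < ρ i - η) :
    Metric.closedBall u R ⊆ ⋃ i, Metric.ball (a i) (ρ i) := by
  intro z hz
  obtain ⟨m, hm⟩ := hnet z hz
  rcases hg m with hfar | ⟨i, hi⟩
  · linarith [dist_triangle_left (g m) u z, Metric.mem_closedBall.1 hz]
  · refine Set.mem_iUnion.2 ⟨i, Metric.mem_ball.2 ?_⟩
    linarith [dist_triangle z (g m) (a i)]

theorem exists_margin_of_closedBall_subset_iUnion_ball {E : Type*} [NormedAddCommGroup E]
    [NormedSpace ℝ E] [ProperSpace E] {a : ι → E} {ρ : ι → ℝ} {u : E} {R : ℝ} (hR : 0 ≤ R)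
    (hcover : Metric.closedBall u R ⊆ ⋃ i, Metric.ball (a i) (ρ i)) :
    ∃ δ > 0, ∀ η, 0 ≤ η → η < δ →
      ∀ g, R + η < dist g u ∨ ∃ i, dist g (a i) < ρ i - η := by
  have hcompact := isCompact_closedBall u R
  obtain ⟨δ, hδ, hdeep⟩ := exists_forall_mem_dist_add_lt_of_isCompact hcompact hcover
  refine ⟨δ / 2, half_pos hδ, fun η hη hηδ g => (lt_or_ge (R + η) (dist g u)).imp_right ?_⟩
  intro hg
  have hthick : g ∈ Metric.cthickening η (Metric.closedBall u R) := by
    rwa [cthickening_closedBall hη hR, Metric.mem_closedBall, add_comm]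
  rw [hcompact.cthickening_eq_biUnion_closedBall hη] at hthick
  obtain ⟨w, hw, hgw⟩ := Set.mem_iUnion₂.1 hthick
  obtain ⟨i, hi⟩ := hdeep w hw
  exact ⟨i, by linarith [dist_triangle g w (a i), Metric.mem_closedBall.1 hgw]⟩

end CoveringClosedBalls

section RationalVectors

variable {n : ℕ}

/-- A rational vector as a point of Euclidean space; `rationalPoint` is the version for
sequences. -/
def ratPoint (u : Fin n → ℚ) : EuclideanSpace ℝ (Fin n) :=
  WithLp.toLp 2 fun i => (u i : ℝ)

theorem denseRange_ratPoint : DenseRange (ratPoint (n := n)) :=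
  (WithLp.toLp_surjective 2).denseRange.comp
    (DenseRange.piMap fun _ => Rat.denseRange_cast) (PiLp.continuous_toLp 2 _)

theorem denseRange_rationalPoint {α : ℕ → Fin n → ℚ} (hα : Function.Surjective α) :
    DenseRange (rationalPoint α) := by
  have h := denseRange_ratPoint (n := n)
  rwa [DenseRange, ← hα.range_comp] at h

theorem dist_ratPoint (u v : Fin n → ℚ) :
    dist (ratPoint u) (ratPoint v) = √((∑ i, (u i - v i) * (u i - v i) : ℚ) : ℝ) := by
  simp [EuclideanSpace.dist_eq, ratPoint, Real.dist_eq, sq]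

theorem dist_ratPoint_lt_iff {u v : Fin n → ℚ} {q : ℚ} : dist (ratPoint u) (ratPoint v) < q ↔
    0 < q ∧ ∑ i, (u i - v i) * (u i - v i) < q * q := by
  rw [dist_ratPoint, ← Rat.cast_lt (K := ℝ) (q := q * q), Rat.cast_mul, ← sq]
  constructor
  · intro h
    have hq : (0 : ℝ) < q := (Real.sqrt_nonneg _).trans_lt h
    exact ⟨Rat.cast_pos.1 hq, (Real.sqrt_lt' hq).1 h⟩
  · exact fun ⟨hq, h⟩ => (Real.sqrt_lt' (Rat.cast_pos.2 hq)).2 h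

theorem lt_dist_ratPoint_iff {u v : Fin n → ℚ} {q : ℚ} :
    (q : ℝ) < dist (ratPoint u) (ratPoint v) ↔ q < 0 ∨ q * q < ∑ i, (u i - v i) * (u i - v i) := by
  rw [dist_ratPoint, ← Rat.cast_lt (K := ℝ) (p := q * q), Rat.cast_mul, ← sq,
    ← Rat.cast_lt_zero (K := ℝ)]
  constructor
  · exact fun h => (lt_or_ge (q : ℝ) 0).imp_right fun hq => (Real.lt_sqrt hq).1 h
  · rintro (hq | h)
    · exact hq.trans_le (Real.sqrt_nonneg _)
    · exact Real.lt_sqrt_of_sq_lt h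

section Computability

variable {β Z : Type*} [Primcodable β] {N : (ℕ → ℕ) → Z → Prop} {u v : β → Fin n → ℚ}

theorem ComputableRat.sum_sub_mul_self (hu : ∀ i, ComputableRat fun b => u b i)
    (hv : ∀ i, ComputableRat fun b => v b i) :
    ComputableRat fun b => ∑ i, (u b i - v b i) * (u b i - v b i) :=
  .sum fun i => ((hu i).sub (hv i)).mul ((hu i).sub (hv i))

theorem upperSemicomputable_dist_ratPoint (hu : ∀ i, ComputableRat fun b => u b i)
    (hv : ∀ i, ComputableRat fun b => v b i) :
    UpperSemicomputable N fun _ b => dist (ratPoint (u b)) (ratPoint (v b)) := by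
  have hq : ComputableRat fun t : β × ℕ => ratSeq t.2 := computableRat_ratSeq.comp .snd
  have h := (SemidecidableOn.of_computablePred (N := N) ((ComputableRat.const 0).lt hq)).and
    (.of_computablePred (((ComputableRat.sum_sub_mul_self hu hv).comp .fst).lt (hq.mul hq)))
  simpa only [UpperSemicomputable, dist_ratPoint_lt_iff] using h

theorem lowerSemicomputable_dist_ratPoint (hu : ∀ i, ComputableRat fun b => u b i)
    (hv : ∀ i, ComputableRat fun b => v b i) :
    LowerSemicomputable N fun _ b => dist (ratPoint (u b)) (ratPoint (v b)) := by
  have hq : ComputableRat fun t : β × ℕ => ratSeq t.2 := computableRat_ratSeq.comp .snd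
  have h := (SemidecidableOn.of_computablePred (N := N) (hq.lt (ComputableRat.const 0))).or
    (.of_computablePred ((hq.mul hq).lt ((ComputableRat.sum_sub_mul_self hu hv).comp .fst)))
  simpa only [LowerSemicomputable, lt_dist_ratPoint_iff] using h

end Computability

end RationalVectors

section CubicalGrids

variable {n : ℕ}

theorem euclideanSpace_dist_le_card_mul {x y : EuclideanSpace ℝ (Fin n)} {δ : ℝ} (hδ : 0 ≤ δ)
    (h : ∀ j, |x j - y j| ≤ δ) : dist x y ≤ n * δ := by
  rw [EuclideanSpace.dist_eq]
  refine Real.sqrt_le_iff.2 ⟨by positivity, ?_⟩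
  calc ∑ i, dist (x i) (y i) ^ 2 ≤ ∑ _i : Fin n, δ ^ 2 :=
        Finset.sum_le_sum fun i _ => pow_le_pow_left₀ dist_nonneg (h i) 2
    _ = n * δ ^ 2 := by simp
    _ ≤ (n * n : ℝ) * δ ^ 2 := by
        gcongr
        exact_mod_cast Nat.le_mul_self n
    _ = (n * δ) ^ 2 := by ring

/-- The points of the grid of mesh `1 / M` in the cube with centre `u` and half side `M`. The digits
of the index `m` in base `2 * M ^ 2 + 1` are the coordinates relative to a corner of the cube. -/
def gridPoint (u : Fin n → ℚ) (M m : ℕ) (j : Fin n) : ℚ :=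
  u j - M + (m / (2 * M ^ 2 + 1) ^ (j : ℕ) % (2 * M ^ 2 + 1) : ℕ) * (M : ℚ)⁻¹

theorem exists_abs_sub_mul_inv_le {M : ℕ} (hM : 0 < M) {t : ℝ} (ht : |t| ≤ M) :
    ∃ d < 2 * M ^ 2 + 1, |t + M - d * (M : ℝ)⁻¹| ≤ (M : ℝ)⁻¹ := by
  have hM' : (0 : ℝ) < M := Nat.cast_pos.2 hM
  obtain ⟨hlower, hupper⟩ := abs_le.1 ht
  have hnonneg : 0 ≤ (t + M) * M := mul_nonneg (by linarith) hM'.le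
  refine ⟨⌊(t + M) * M⌋₊, Nat.lt_succ_of_le (Nat.floor_le_of_le ?_), ?_⟩
  · push_cast
    nlinarith
  · have hfloor := Nat.floor_le hnonneg
    have hfloor' := Nat.lt_floor_add_one ((t + M) * M)
    rw [show t + M - ⌊(t + M) * M⌋₊ * (M : ℝ)⁻¹ = ((t + M) * M - ⌊(t + M) * M⌋₊) * (M : ℝ)⁻¹ by
      field_simp, abs_mul, abs_of_pos (inv_pos.2 hM')]
    refine mul_le_of_le_one_left (inv_pos.2 hM').le (abs_le.2 ⟨?_, ?_⟩) <;> linarith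

theorem exists_dist_gridPoint_le (u : Fin n → ℚ) {M : ℕ} (hM : 0 < M)
    {z : EuclideanSpace ℝ (Fin n)} (hz : dist z (ratPoint u) ≤ M) :
    ∃ m < (2 * M ^ 2 + 1) ^ n, dist z (ratPoint (gridPoint u M m)) ≤ n * (M : ℝ)⁻¹ := by
  have hcoord : ∀ j, |z j - u j| ≤ M := fun j =>
    (PiLp.dist_apply_le z (ratPoint u) j).trans hz
  choose d hdB hd using fun j => exists_abs_sub_mul_inv_le hM (hcoord j)
  let digits : Fin n → Fin (2 * M ^ 2 + 1) := fun j => ⟨d j, hdB j⟩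
  refine ⟨finFunctionFinEquiv digits, (finFunctionFinEquiv digits).2,
    euclideanSpace_dist_le_card_mul (by positivity) fun j => ?_⟩
  have hdigit : (finFunctionFinEquiv digits : ℕ) / (2 * M ^ 2 + 1) ^ (j : ℕ) % (2 * M ^ 2 + 1) =
      d j := congrArg Fin.val (congrFun (finFunctionFinEquiv.symm_apply_apply digits) j)
  convert hd j using 2
  simp only [ratPoint, gridPoint, hdigit]
  push_cast
  ring

theorem computableRat_gridPoint {β : Type*} [Primcodable β] {u : β → Fin n → ℚ}
    (hu : ∀ j, ComputableRat fun b => u b j) {M m : β → ℕ} (hM : Computable M)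
    (hm : Computable m) (j : Fin n) : ComputableRat fun b => gridPoint (u b) (M b) (m b) j := by
  have hbase : Computable fun b => 2 * M b ^ 2 + 1 :=
    Computable.succ.comp (computable_nat_mul (.const 2) (computable_nat_pow hM (.const 2)))
  have hdigit := Primrec.nat_mod.to_comp.comp
    (Primrec.nat_div.to_comp.comp hm (computable_nat_pow hbase (.const (j : ℕ)))) hbase
  exact ((hu j).sub (.natCast hM)).add ((ComputableRat.natCast hdigit).mul (.natCast_inv hM))

theorem closedBall_ratPoint_subset_iUnion_ball_iff {ι : Type*} {a : ι → EuclideanSpace ℝ (Fin n)}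
    {ρ : ι → ℝ} {u : Fin n → ℚ} {R : ℝ} (hR : 0 ≤ R) :
    Metric.closedBall (ratPoint u) R ⊆ ⋃ i, Metric.ball (a i) (ρ i) ↔
      ∃ M : ℕ, R < M ∧ ∀ m < (2 * M ^ 2 + 1) ^ n,
        R + n * (M : ℝ)⁻¹ < dist (ratPoint (gridPoint u M m)) (ratPoint u) ∨
          ∃ i, dist (ratPoint (gridPoint u M m)) (a i) < ρ i - n * (M : ℝ)⁻¹ := by
  constructor
  · intro hcover
    obtain ⟨δ, hδ, hmargin⟩ := exists_margin_of_closedBall_subset_iUnion_ball hR hcover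
    have hmesh : Tendsto (fun M : ℕ => n * (M : ℝ)⁻¹) atTop (𝓝 0) := by
      simpa using tendsto_inv_atTop_nhds_zero_nat.const_mul (n : ℝ)
    obtain ⟨M, hM, hRM⟩ := ((hmesh.eventually_lt_const hδ).and
      (tendsto_natCast_atTop_atTop.eventually_gt_atTop R)).exists
    exact ⟨M, hRM, fun m _ => hmargin _
      (mul_nonneg n.cast_nonneg (inv_nonneg.2 M.cast_nonneg)) hM _⟩
  · rintro ⟨M, hRM, hgrid⟩
    have hnet : ∀ z ∈ Metric.closedBall (ratPoint u) R, ∃ m : Fin ((2 * M ^ 2 + 1) ^ n),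
        dist z (ratPoint (gridPoint u M m)) ≤ n * (M : ℝ)⁻¹ := fun z hz => by
      obtain ⟨m, hm, hzm⟩ := exists_dist_gridPoint_le u (Nat.cast_pos.1 (hR.trans_lt hRM))
        ((Metric.mem_closedBall.1 hz).trans hRM.le)
      exact ⟨⟨m, hm⟩, hzm⟩
    exact closedBall_subset_iUnion_ball_of_net hnet fun m => hgrid m m.isLt

end CubicalGrids

section EuclideanClosedSets

variable {n : ℕ} {α : ℕ → Fin n → ℚ} {r : ℕ → ℚ}

theorem upperSemicomputable_dist_rationalPoint {Z : Type*} {N : (ℕ → ℕ) → Z → Prop}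
    (hα : ∀ i, IsComputableRatSeq fun k => α k i) : UpperSemicomputable N fun _ (t : ℕ × ℕ) =>
      dist (rationalPoint α t.1) (rationalPoint α t.2) := by
  have hfst : ∀ i, ComputableRat fun t : ℕ × ℕ => α t.1 i := fun i => ComputableRat.comp (hα i) .fst
  have hsnd : ∀ i, ComputableRat fun t : ℕ × ℕ => α t.2 i := fun i => ComputableRat.comp (hα i) .snd
  exact upperSemicomputable_dist_ratPoint hfst hsnd

theorem semidecidableOn_exists_dist_gridPoint_lt (hα : ∀ i, IsComputableRatSeq fun k => α k i)
    (hr : IsComputableRatSeq r) :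
    SemidecidableOn (@Eq (ℕ → ℕ)) fun p (t : (ℕ × ℕ) × ℕ) =>
      ∃ h, dist (ratPoint (gridPoint (α t.1.1.unpair.1) t.1.2 t.2))
        (rationalPoint α (p (2 * h)).unpair.1) < r (p (2 * h)).unpair.2 - n * (t.1.2 : ℝ)⁻¹ := by
  have hgrid : ∀ j, ComputableRat fun t : ((ℕ × ℕ) × ℕ) × ℕ =>
      gridPoint (α t.1.1.1.unpair.1) t.1.1.2 t.1.2 j :=
    computableRat_gridPoint (fun j => ComputableRat.comp (hα j)
      (.comp .fst (.comp .unpair (.comp .fst (.comp .fst .fst)))))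
      (.comp .snd (.comp .fst .fst)) (.comp .snd .fst)
  have hdeep := (upperSemicomputable_dist_ratPoint (N := @Eq (ℕ → ℕ)) hgrid fun j =>
    ComputableRat.comp (hα j) (.comp .fst (.comp .unpair .snd))).lt_ratCast
      ((ComputableRat.comp hr (.comp .snd (.comp .unpair .snd))).sub
        ((ComputableRat.const n).mul (.natCast_inv (.comp .snd (.comp .fst .fst)))))
  have hentry : SemidecidableOn (@Eq (ℕ → ℕ)) fun p (t : ((ℕ × ℕ) × ℕ) × ℕ) =>
      dist (ratPoint (gridPoint (α t.1.1.1.unpair.1) t.1.1.2 t.1.2))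
        (rationalPoint α (p (2 * t.2)).unpair.1) <
          r (p (2 * t.2)).unpair.2 - n * (t.1.1.2 : ℝ)⁻¹ :=
    hdeep.comp_of_iff .id ((OracleComputable.of_computable .fst).pair
      (OracleComputable.oracle.comp (.of_computable (computable_two_mul.comp .snd))))
        fun p _ hp => ⟨p, rfl, fun t => by simp [← hp, rationalPoint, ratPoint]⟩
  exact hentry.exists_nat

theorem semidecidableOn_closedBall_subset (hα : ∀ i, IsComputableRatSeq fun k => α k i)
    (hr : IsEffectiveRadiusEnumeration r) :
    SemidecidableOn (@Eq (ℕ → ℕ)) fun p (k : ℕ) =>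
      Metric.closedBall (rationalPoint α k.unpair.1) (r k.unpair.2) ⊆
        ⋃ h, basicBall (rationalPoint α) r (p (2 * h)) := by
  have hcenter : ∀ j, ComputableRat fun t : (ℕ × ℕ) × ℕ => α t.1.1.unpair.1 j := fun j =>
    ComputableRat.comp (hα j) (.comp .fst (.comp .unpair (.comp .fst .fst)))
  have hradius : ComputableRat fun k : ℕ => r k.unpair.2 := hr.computableRat_radius
  have hfar := (lowerSemicomputable_dist_ratPoint (N := @Eq (ℕ → ℕ))
    (computableRat_gridPoint hcenter (.comp .snd .fst) .snd) hcenter).ratCast_lt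
      ((hradius.comp (.comp .fst .fst)).add
        ((ComputableRat.const n).mul (.natCast_inv (.comp .snd .fst))))
  have hcount : Computable fun t : ℕ × ℕ => (2 * t.2 ^ 2 + 1) ^ n :=
    computable_nat_pow (Computable.succ.comp (computable_nat_mul (.const 2)
      (computable_nat_pow .snd (.const 2)))) (.const n)
  have hlarge : SemidecidableOn (@Eq (ℕ → ℕ)) fun _ (t : ℕ × ℕ) => (r t.1.unpair.2 : ℝ) < t.2 := by
    simpa only [← Rat.cast_lt (K := ℝ), Rat.cast_natCast] using
      SemidecidableOn.of_computablePred ((hradius.comp .fst).lt (.natCast .snd))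
  have hgrid := (hfar.or (semidecidableOn_exists_dist_gridPoint_lt hα hr.1)).forall_lt hcount
  have hsearch := (hlarge.and hgrid).exists_nat
  refine hsearch.comp_of_iff .id (.of_computable .id) fun p _ hp => ⟨p, rfl, fun k => ?_⟩
  have hnonneg : 0 ≤ r k.unpair.2 := hr.2.subset ⟨_, rfl⟩
  refine (closedBall_ratPoint_subset_iUnion_ball_iff (Rat.cast_nonneg.2 hnonneg)).trans ?_
  simp only [← hp, id, Rat.cast_add, Rat.cast_mul, Rat.cast_inv, Rat.cast_natCast]

end EuclideanClosedSets

theorem mainTheorem9 (n : ℕ) (hn : 1 ≤ n) (ε : ℝ) (hε : 0 < ε)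
    (α : ℕ → Fin n → ℚ) (hα : IsEffectiveEnumeration α)
    (r : ℕ → ℚ) (hr : IsEffectiveRadiusEnumeration r) :
    ComputableMultimap
      ((cauchyRep (rationalPoint α)).prod (totalRep (rationalPoint α) r))
      (cauchyRep (rationalPoint α))
      (approxProjection (EuclideanSpace ℝ (Fin n)) ε) := by
  have hball : SemidecidableOn (totalRep (rationalPoint α) r).IsName fun A (k : ℕ) =>
      Disjoint (Metric.closedBall (rationalPoint α k.unpair.1) (r k.unpair.2)) (A : Set _) :=
    (semidecidableOn_closedBall_subset hα.1 hr).comp_of_iff .id (.of_computable .id)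
      fun p A hA => ⟨p, rfl, fun _ => disjoint_iff_subset_iUnion_basicBall hA.1⟩
  exact computableMultimap_approxProjection (denseRange_rationalPoint hα.2) hr
    (upperSemicomputable_dist_rationalPoint hα.1) hball hε
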